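/- Let $r>1$ be a real number, let $m\ge 2$ and $k\ge m-1$ be integers, let $\Omega\subseteq\mathbb{R}^m$ be open, and let $f:\Omega\to\mathbb{C}$ be of class $C^{k,1}$, i.e. $f$ is $C^k$ and its partial derivatives of order $k$ are locally Lipschitz on $\Omega$. Put $\Omega_0:=\Omega\setminus f^{-1}(0)$ and $\operatorname{sgn}(f):=f/|f|:\Omega_0\to\mathbb{S}^1$. Then there exist a (possibly empty) $C^k$-hypersurface $E\subseteq\Omega$ (embedded, closed in $\Omega_0$ but not necessarily in $\Omega$) and a continuous function $\lambda:\Omega\setminus E\to\mathbb{C}$ such that $\lambda^r=f$ on $\Omega\setminus E$. Moreover, $E$ can be taken of the form $E=\operatorname{sgn}(f)^{-1}(v)$, where $v\in\mathbb{S}^1$ is a regular value of $\operatorname{sgn}(f)$ (points of $\mathbb{S}^1$ outside the image count as regular values). Here $\lambda^r=f$ means that $\lambda$ vanishes at the zeros of $f$ and that, at the points of $\Omega\setminus E$ where $f\ne0$, $\lambda=\exp(r^{-1}\log f)$ for some function $\log f$, not necessarily continuous, with $\exp(\log f)=f$. -/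

import Mathlib

/-- `f` is of class `C^{k,1}` on the open set `Ω`: it is `C^k` on `Ω` and its derivatives of
order `k` are locally Lipschitz on `Ω`. -/
def IsCkLip {m : ℕ} (k : ℕ) (f : EuclideanSpace ℝ (Fin m) → ℂ)
    (Ω : Set (EuclideanSpace ℝ (Fin m))) : Prop :=
  ContDiffOn ℝ k f Ω ∧ LocallyLipschitzOn Ω (iteratedFDeriv ℝ k f)

/-- `E` is a (possibly empty, embedded, not necessarily closed) hypersurface of class `C^k`,
`k ≥ 1`, in `ℝ^m`: near each of its points it is the zero set of a real `C^k` function without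
critical points. -/
def IsCkHypersurface {m : ℕ} (k : ℕ) (E : Set (EuclideanSpace ℝ (Fin m))) : Prop :=
  ∀ x ∈ E, ∃ (U : Set (EuclideanSpace ℝ (Fin m))) (g : EuclideanSpace ℝ (Fin m) → ℝ),
    IsOpen U ∧ x ∈ U ∧ ContDiffOn ℝ k g U ∧ (∀ y ∈ U, fderiv ℝ g y ≠ 0) ∧
      E ∩ U = {y ∈ U | g y = 0}

/-- The sign `f / |f|` of a complex-valued function (used only where `f` does not vanish). -/
noncomputable def sgnFun {m : ℕ} (f : EuclideanSpace ℝ (Fin m) → ℂ) :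
    EuclideanSpace ℝ (Fin m) → ℂ :=
  fun x => f x / (‖f x‖ : ℂ)

/-- The preimage of `v` under the map `sgn f : {x ∈ Ω | f x ≠ 0} → 𝕊¹`. -/
def sgnFiber {m : ℕ} (f : EuclideanSpace ℝ (Fin m) → ℂ)
    (Ω : Set (EuclideanSpace ℝ (Fin m))) (v : ℂ) : Set (EuclideanSpace ℝ (Fin m)) :=
  {x ∈ Ω | f x ≠ 0 ∧ sgnFun f x = v}

/-- `v ∈ 𝕊¹` is a regular value of `sgn f : {x ∈ Ω | f x ≠ 0} → 𝕊¹`: at every preimage of `v`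
the differential maps onto the tangent line `T_v 𝕊¹ = ℝ i v`. Points outside the image are
regular values. -/
def IsRegularValueSgn {m : ℕ} (f : EuclideanSpace ℝ (Fin m) → ℂ)
    (Ω : Set (EuclideanSpace ℝ (Fin m))) (v : ℂ) : Prop :=
  ‖v‖ = 1 ∧ ∀ x ∈ sgnFiber f Ω v, DifferentiableAt ℝ (sgnFun f) x ∧
    Set.range (fderiv ℝ (sgnFun f) x) = {w : ℂ | ∃ t : ℝ, w = t * (Complex.I * v)}

/-- `u` solves `u ^ r = f` on `S`: it vanishes at the zeros of `f`, and off them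
`u = exp (r⁻¹ log f)` for some (not necessarily continuous) choice `L` of the logarithm of `f`. -/
def IsRadicalOn {m : ℕ} (r : ℝ) (f u : EuclideanSpace ℝ (Fin m) → ℂ)
    (S : Set (EuclideanSpace ℝ (Fin m))) : Prop :=
  (∀ x ∈ S, f x = 0 → u x = 0) ∧
    ∃ L : EuclideanSpace ℝ (Fin m) → ℂ, ∀ x ∈ S, f x ≠ 0 →
      Complex.exp (L x) = f x ∧ u x = Complex.exp ((r : ℂ)⁻¹ * L x)

/-! ### Countable covers by flat pieces (generalized Morse lemma) -/

section Sard

open Set Filter Topology Asymptotics MeasureTheory Module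
open scoped NNReal ENNReal unitInterval

variable {E F G P : Type}
  [NormedAddCommGroup E] [NormedSpace ℝ E]
  [NormedAddCommGroup F] [NormedSpace ℝ F]
  [NormedAddCommGroup G] [NormedSpace ℝ G]
  [NormedAddCommGroup P] [NormedSpace ℝ P]

/-! A branch of the logarithm cut along the ray through `v` is continuous off that ray, so off the
fiber of `v` it gives a continuous r-th root of `f`; at the zeros of `f` the root is continuous
because its modulus is |f|^(1/r). The work lies in choosing `v`. For v = e^{it} with -π < t < π, the
fiber is {arg f = t}, so `v` is regular as soon as t is not a critical value of arg f. Such a t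
exists by a Morse–Sard theorem for real functions of class C^{m-1,1} on ℝ^m
(`volume_image_critical_eq_zero`), one derivative short of what the usual o-estimate would need.

Its first ingredient is a generalized Morse lemma (`hasFlatCover`): any set A is covered by
countably many C^1 pieces ψ(B) such that every C^{k+(1)} function vanishing on A is O(‖x - y‖^(k+1))
along ψ at the points y of B. Applied with k = m - 2 to the differential of a function h on its
critical set, and integrated once, it gives h(ψ x) - h(ψ y) = O(‖x - y‖^m).

This only bounds the measure of the image. The second ingredient
(`exists_forall_dist_le_of_density`) uses Lebesgue density: near a density point of B, two points of
B at distance r are joined through B by L steps of length O(r/L), at total cost O(L (r/L)^m). As m ≥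
2 and L is arbitrary, O becomes o at almost every point, and the image is null. -/

theorem ContDiffPointwiseHolderAt.of_fderiv {k : ℕ} {α : I} {f : E → F} {a : E}
    (hf : ContDiffAt ℝ (k + 1 : ℕ) f a) (hd : ContDiffPointwiseHolderAt k α (fderiv ℝ f) a) :
    ContDiffPointwiseHolderAt (k + 1) α f a where
  contDiffAt := hf
  isBigO := .of_norm_left <| by
    simpa [iteratedFDeriv_succ_eq_comp_right, Function.comp_def, ← dist_eq_norm_sub]
      using hd.isBigO.norm_left

/-- A local inverse of a `C^{k+(α)}` diffeomorphism is of class `C^{k+(α)}`. -/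
theorem OpenPartialHomeomorph.contDiffPointwiseHolderAt_symm [CompleteSpace E] {k : ℕ} {α : I}
    (Φ : OpenPartialHomeomorph E F) {b : F} (hb : b ∈ Φ.target) {Φ' : E ≃L[ℝ] F}
    (hd : HasFDerivAt Φ (Φ' : E →L[ℝ] F) (Φ.symm b))
    (hΦ : ContDiffPointwiseHolderAt (k + 1) α Φ (Φ.symm b)) :
    ContDiffPointwiseHolderAt (k + 1) α Φ.symm b := by
  have hs : ContDiffAt ℝ (k + 1 : ℕ) Φ.symm b := Φ.contDiffAt_symm hb hd hΦ.contDiffAt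
  refine .of_fderiv hs ?_
  -- D(Φ⁻¹) = inv ∘ DΦ ∘ Φ⁻¹ near b. The inverse function theorem already makes Φ⁻¹ of class
  -- C^{k+1}, hence C^{k+(α)}, so all three factors are C^{k+(α)} and no induction on k is needed.
  have hev : (ContinuousLinearMap.inverse ∘ (fderiv ℝ Φ ∘ Φ.symm)) =ᶠ[𝓝 b] fderiv ℝ Φ.symm := by
    have h1 : ∀ᶠ y in 𝓝 b, y ∈ Φ.target := Φ.open_target.mem_nhds hb
    have hc : ContinuousAt (fun y => fderiv ℝ Φ (Φ.symm y)) b :=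
      ((hΦ.fderiv (Nat.lt_succ_self k)).continuousAt).comp (f := Φ.symm) (Φ.continuousAt_symm hb)
    have h2 : ∀ᶠ y in 𝓝 b, fderiv ℝ Φ (Φ.symm y) ∈ range ((↑) : (E ≃L[ℝ] F) → E →L[ℝ] F) :=
      hc.eventually_mem (by
        rw [hd.fderiv]; exact ContinuousLinearEquiv.nhds Φ')
    have h3 : ∀ᶠ y in 𝓝 b, DifferentiableAt ℝ Φ (Φ.symm y) :=
      (Φ.continuousAt_symm hb).eventually
        ((hΦ.contDiffAt.eventually (by simp)).mono fun z hz => hz.differentiableAt (by simp))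
    filter_upwards [h1, h2, h3] with y hy1 ⟨e, he⟩ hy3
    have : HasFDerivAt Φ (e : E →L[ℝ] F) (Φ.symm y) := by rw [he]; exact hy3.hasFDerivAt
    rw [(Φ.hasFDerivAt_symm hy1 this).fderiv, Function.comp_apply, Function.comp_apply, ← he,
      ContinuousLinearMap.inverse_equiv]
  refine ContDiffPointwiseHolderAt.congr_of_eventuallyEq ?_ hev
  have hinv : ContDiffAt ℝ (k + 1 : ℕ) (ContinuousLinearMap.inverse : (E →L[ℝ] F) → (F →L[ℝ] E))
      (fderiv ℝ Φ (Φ.symm b)) := by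
    rw [hd.fderiv]; exact contDiffAt_map_inverse Φ'
  have hs' : ContDiffPointwiseHolderAt k α Φ.symm b :=
    hs.contDiffPointwiseHolderAt (by norm_cast; simp) α
  have hsd : DifferentiableAt ℝ Φ.symm b := hs.differentiableAt (by simp)
  have h4 : ContDiffPointwiseHolderAt k α (fderiv ℝ Φ ∘ Φ.symm) b :=
    ContDiffPointwiseHolderAt.comp_of_differentiableAt b (hΦ.fderiv (Nat.lt_succ_self k)) hs'
      (.inr hsd)
  exact ContDiffPointwiseHolderAt.comp_of_differentiableAt b
    (hinv.contDiffPointwiseHolderAt (by norm_cast; simp) α) h4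
    (.inl (hinv.differentiableAt (by simp)))

/-- If the derivative of `h` is `O(‖x - y‖ ^ j)` at `y`, then `h x - h y = O(‖x - y‖ ^ (j + 1))`. -/
theorem isBigO_sub_pow_succ_of_fderiv {h : P → G} {y : P} {j : ℕ}
    (hd : ∀ᶠ x in 𝓝 y, DifferentiableAt ℝ h x)
    (hO : fderiv ℝ h =O[𝓝 y] fun x => ‖x - y‖ ^ j) :
    (fun x => h x - h y) =O[𝓝 y] fun x => ‖x - y‖ ^ (j + 1) := by
  obtain ⟨C, hC⟩ := hO.bound
  obtain ⟨ε, hε, hball⟩ := Metric.eventually_nhds_iff_ball.1 (hd.and hC)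
  refine .of_bound C ?_
  filter_upwards [Metric.ball_mem_nhds y hε] with x hx
  have hsub : ∀ z ∈ Metric.closedBall y ‖x - y‖, z ∈ Metric.ball y ε := fun z hz =>
    (Metric.mem_closedBall.1 hz).trans_lt (by rw [← dist_eq_norm]; exact hx)
  have hCn : 0 ≤ C * ‖x - y‖ ^ j := by
    have := (hball x hx).2
    simp only [norm_pow, norm_norm] at this
    exact (norm_nonneg _).trans this
  have := (convex_closedBall y ‖x - y‖).norm_image_sub_le_of_norm_fderiv_le (𝕜 := ℝ) (f := h)
    (C := C * ‖x - y‖ ^ j) (x := y) (y := x)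
    (fun z hz => (hball z (hsub z hz)).1) (fun z hz => ?_)
    (Metric.mem_closedBall_self (norm_nonneg _)) (by simp [dist_eq_norm])
  · simpa [pow_succ, mul_assoc] using this
  · have h1 := (hball z (hsub z hz)).2
    simp only [norm_pow, norm_norm] at h1
    have h2 : ‖z - y‖ ≤ ‖x - y‖ := by simpa [dist_eq_norm] using hz
    rcases le_or_gt 0 C with hC0 | hC0
    · exact h1.trans (by gcongr)
    · have : ‖fderiv ℝ h z‖ ≤ 0 :=
        h1.trans (mul_nonpos_of_nonpos_of_nonneg hC0.le (by positivity))
      exact this.trans hCn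

/-- By the chain rule the derivative of g ∘ ψ inherits the bound on Dg along ψ, since Dψ is bounded
near y; integrating gains one power. -/
theorem isBigO_comp_sub_pow_succ {g : F → G} {ψ : P → F} {y : P} {j : ℕ}
    (hg : ContDiffAt ℝ 1 g (ψ y)) (hψ : ContDiffAt ℝ 1 ψ y)
    (hO : (fun x => fderiv ℝ g (ψ x)) =O[𝓝 y] fun x => ‖x - y‖ ^ j) :
    (fun x => g (ψ x) - g (ψ y)) =O[𝓝 y] fun x => ‖x - y‖ ^ (j + 1) := by
  have e1 : ∀ᶠ x in 𝓝 y, DifferentiableAt ℝ ψ x :=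
    (hψ.eventually (by simp)).mono fun z hz => hz.differentiableAt (by simp)
  have e2 : ∀ᶠ x in 𝓝 y, DifferentiableAt ℝ g (ψ x) :=
    hψ.continuousAt.eventually
      ((hg.eventually (by simp)).mono fun z hz => hz.differentiableAt (by simp))
  refine isBigO_sub_pow_succ_of_fderiv (h := fun x => g (ψ x)) ?_ ?_
  · filter_upwards [e1, e2] with x h1 h2 using h2.comp x h1
  · have hb : fderiv ℝ ψ =O[𝓝 y] fun _ => (1 : ℝ) :=
      ((hψ.fderiv_right (m := 0) (by simp)).continuousAt).isBigO_one ℝ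
    have key : fderiv ℝ (fun x => g (ψ x)) =O[𝓝 y]
        fun x => ‖fderiv ℝ g (ψ x)‖ * ‖fderiv ℝ ψ x‖ := by
      refine .of_bound 1 ?_
      filter_upwards [e1, e2] with x h1 h2
      rw [show fderiv ℝ (fun x => g (ψ x)) x = (fderiv ℝ g (ψ x)).comp (fderiv ℝ ψ x) from
        fderiv_comp x h2 h1, one_mul, Real.norm_of_nonneg (by positivity)]
      exact ContinuousLinearMap.opNorm_comp_le _ _
    simpa using key.trans (hO.norm_left.mul hb.norm_left)

/-- Near `x`, the function `g` vanishes on `A` and is of class `C^{k+(1)}` at the points of `A`. -/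
def VanishesNear (k : ℕ) (A : Set F) (g : F → G) (x : F) : Prop :=
  ∀ᶠ z in 𝓝[A] x, g z = 0 ∧ ContDiffPointwiseHolderAt k 1 g z

/-- A `C^1` parametrization `ψ`, defined near `B`, of a part of `A` such that functions of class
`C^{k+(1)}` vanishing on `A` are `O(‖x - y‖ ^ (k + 1))` at `y ∈ B` in this parametrization. -/
structure IsFlatPiece (k : ℕ) (A : Set F) (ψ : P → F) (B : Set P) : Prop where
  contDiffAt : ∀ y ∈ B, ContDiffAt ℝ 1 ψ y
  mapsTo : MapsTo ψ B A
  isBigO : ∀ (G : Type) [NormedAddCommGroup G] [NormedSpace ℝ G] (g : F → G), ∀ y ∈ B,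
    VanishesNear k A g (ψ y) → (fun x => g (ψ x)) =O[𝓝 y] fun x => ‖x - y‖ ^ (k + 1)

variable (P) in
/-- The set `S` is covered by countably many flat pieces of `A`. -/
def HasFlatCover (k : ℕ) (A S : Set F) : Prop :=
  ∃ 𝒞 : Set ((P → F) × Set P), 𝒞.Countable ∧ (∀ p ∈ 𝒞, IsFlatPiece k A p.1 p.2) ∧
    S ⊆ ⋃ p ∈ 𝒞, p.1 '' p.2

theorem HasFlatCover.mono {k : ℕ} {A S T : Set F} (h : HasFlatCover P k A T) (hST : S ⊆ T) :
    HasFlatCover P k A S :=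
  let ⟨𝒞, h1, h2, h3⟩ := h
  ⟨𝒞, h1, h2, hST.trans h3⟩

theorem HasFlatCover.union {k : ℕ} {A S T : Set F} (hS : HasFlatCover P k A S)
    (hT : HasFlatCover P k A T) : HasFlatCover P k A (S ∪ T) := by
  obtain ⟨𝒞, h1, h2, h3⟩ := hS
  obtain ⟨𝒟, h1', h2', h3'⟩ := hT
  refine ⟨𝒞 ∪ 𝒟, h1.union h1', fun p hp => hp.elim (h2 p) (h2' p), ?_⟩
  rw [biUnion_union]
  exact union_subset_union h3 h3'

theorem HasFlatCover.biUnion {ι : Type} {k : ℕ} {A : Set F} {t : Set ι} {S : ι → Set F}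
    (ht : t.Countable) (h : ∀ i ∈ t, HasFlatCover P k A (S i)) :
    HasFlatCover P k A (⋃ i ∈ t, S i) := by
  choose! 𝒞 h1 h2 h3 using h
  refine ⟨⋃ i ∈ t, 𝒞 i, ht.biUnion h1, fun p hp => ?_, iUnion₂_subset fun i hi => ?_⟩
  · obtain ⟨i, hi, hp⟩ := mem_iUnion₂.1 hp
    exact h2 i hi p hp
  · exact (h3 i hi).trans (biUnion_subset_biUnion_left (subset_biUnion_of_mem hi))

/-- By Lindelöf, covers need only be found locally. -/
theorem HasFlatCover.of_forall_nhdsWithin [SecondCountableTopology F] {k : ℕ} {A S : Set F}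
    (h : ∀ x ∈ S, ∃ U ∈ 𝓝[S] x, HasFlatCover P k A U) : HasFlatCover P k A S := by
  choose! U hU hc using h
  obtain ⟨t, htS, ht, hcov⟩ := TopologicalSpace.countable_cover_nhdsWithin hU
  exact (HasFlatCover.biUnion ht fun i hi => hc i (htS hi)).mono hcov

/-- At order 0 flatness is the pointwise Lipschitz bound at a zero of g, so a single linear
surjection from P onto F serves as parametrization. -/
theorem hasFlatCover_zero [FiniteDimensional ℝ F] [FiniteDimensional ℝ P]
    (hdim : finrank ℝ F ≤ finrank ℝ P) (A : Set F) : HasFlatCover P 0 A A := by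
  obtain ⟨ℓ, hℓ⟩ : ∃ ℓ : P →ₗ[ℝ] F, Function.Surjective ℓ := by
    obtain ⟨i, hi⟩ := _root_.finrank_le_iff_exists_linearMap.1 hdim
    obtain ⟨s, hs⟩ := i.exists_leftInverse_of_injective (LinearMap.ker_eq_bot.2 hi)
    exact ⟨s, fun x => ⟨i x, LinearMap.congr_fun hs x⟩⟩
  let L := LinearMap.toContinuousLinearMap ℓ
  refine ⟨{((L : P → F), L ⁻¹' A)}, countable_singleton _, ?_, ?_⟩
  · rintro p rfl
    refine ⟨fun y _ => L.contDiff.contDiffAt, fun _ => id, fun G _ _ g y hy hg => ?_⟩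
    obtain ⟨h0, hPH⟩ := hg.self_of_nhdsWithin hy
    have h1 := (ContDiffPointwiseHolderAt.zero_order_iff.1 hPH).2
    have h2 := h1.comp_tendsto (L.continuous.tendsto y)
    simp only [h0, sub_zero, Icc.coe_one, Real.rpow_one] at h2
    refine (h2.trans ?_)
    simp only [zero_add, pow_one]
    refine IsBigO.norm_norm ?_
    simpa [Function.comp_def] using L.isBigO_sub (𝓝 y) y
  · simp only [mem_singleton_iff, iUnion_iUnion_eq_left]
    exact (image_preimage_eq A hℓ).ge

/-- The part of `A` on which all functions vanishing on `A` have zero derivative. -/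
theorem HasFlatCover.succ_of_critical {k : ℕ} {A A' : Set F} (hA' : A' ⊆ A)
    (hcrit : ∀ g : F → ℝ, ∀ x ∈ A', VanishesNear (k + 1) A g x → fderiv ℝ g x = 0)
    (h : HasFlatCover P k A' A') : HasFlatCover P (k + 1) A A' := by
  obtain ⟨𝒞, h1, h2, h3⟩ := h
  refine ⟨𝒞, h1, fun p hp => ⟨(h2 p hp).contDiffAt, (h2 p hp).mapsTo.mono_right hA',
    fun G _ _ g y hy hg => ?_⟩, h3⟩
  have hyA' : p.1 y ∈ A' := (h2 p hp).mapsTo hy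
  obtain ⟨h0, hPH⟩ := hg.self_of_nhdsWithin (hA' hyA')
  -- Dg vanishes on A' and is of class C^{k+(1)} there, so order-k flatness relative to A' gives Dg
  -- = O(‖x - y‖^(k+1)) along the piece.
  have hO := isBigO_comp_sub_pow_succ (j := k + 1) (g := g) (ψ := p.1) (y := y)
    (hPH.contDiffAt.of_le (by norm_cast; omega)) ((h2 p hp).contDiffAt y hy)
    ((h2 p hp).isBigO _ (fderiv ℝ g) y hy ?_)
  · simpa [h0] using hO
  have hg' : ∀ᶠ z in 𝓝[A'] p.1 y, VanishesNear (k + 1) A g z :=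
    (eventually_eventually_nhdsWithin.2 hg).filter_mono (nhdsWithin_mono _ hA')
  filter_upwards [hg', self_mem_nhdsWithin] with z hz hzA'
  obtain ⟨-, hPHz⟩ := hz.self_of_nhdsWithin (hA' hzA')
  refine ⟨?_, hPHz.fderiv (Nat.lt_succ_self k)⟩
  ext w
  -- `hcrit` concerns real-valued functions only; it is applied to ℓ ∘ g for every functional ℓ.
  refine SeparatingDual.eq_zero_of_forall_dual_eq_zero (R := ℝ) fun ℓ => ?_
  have := hcrit (ℓ ∘ g) z hzA' (hz.mono fun u hu =>
    ⟨by simp [hu.1], hu.2.continuousLinearMap_comp ℓ⟩)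
  rw [fderiv_comp z ℓ.differentiableAt (hPHz.differentiableAt (by simp)), ℓ.fderiv] at this
  exact DFunLike.congr_fun this w

/-- Flat covers pass through a parametrization `φ`. -/
theorem HasFlatCover.image {k : ℕ} {A : Set F} {φ : E → F} {A₀ : Set E} (hφA : MapsTo φ A₀ A)
    (hφ : ∀ w ∈ A₀, ContDiffPointwiseHolderAt (k + 1) 1 φ w)
    (h : HasFlatCover P (k + 1) A₀ A₀) : HasFlatCover P (k + 1) A (φ '' A₀) := by
  obtain ⟨𝒞, h1, h2, h3⟩ := h
  refine ⟨(fun p => (φ ∘ p.1, p.2)) '' 𝒞, h1.image _, ?_, ?_⟩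
  · rintro _ ⟨p, hp, rfl⟩
    have hp' := h2 p hp
    refine ⟨fun y hy => ?_, hφA.comp hp'.mapsTo, fun G _ _ g y hy hg => ?_⟩
    · exact ((hφ _ (hp'.mapsTo hy)).contDiffAt.of_le (by norm_cast; omega)).comp y
        (hp'.contDiffAt y hy)
    · refine hp'.isBigO G (g ∘ φ) y hy ?_
      have hc : Tendsto φ (𝓝[A₀] p.1 y) (𝓝[A] φ (p.1 y)) :=
        tendsto_nhdsWithin_of_tendsto_nhds_of_eventually_within _
          ((hφ _ (hp'.mapsTo hy)).continuousAt.tendsto.mono_left nhdsWithin_le_nhds)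
          (eventually_mem_nhdsWithin.mono hφA)
      filter_upwards [hc.eventually hg, self_mem_nhdsWithin] with z hz hzA
      exact ⟨hz.1, hz.2.comp z (hφ z hzA) (by simp)⟩
  · rw [biUnion_image]
    refine (image_mono h3).trans ?_
    rw [image_iUnion₂]
    simp only [image_comp]
    exact subset_rfl

/-- Near a point where a function vanishing on `A` has nonzero derivative, `A` is contained in the
image of a parametrized hypersurface. -/
theorem exists_parametrization [FiniteDimensional ℝ F] {k : ℕ} {A : Set F} {g : F → ℝ} {x : F}
    (hx : x ∈ A) (hg : VanishesNear (k + 1) A g x) (hd : fderiv ℝ g x ≠ 0) :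
    ∃ (K : Submodule ℝ F) (φ : K → F) (A₀ : Set K), finrank ℝ K < finrank ℝ F ∧
      MapsTo φ A₀ A ∧ (∀ w ∈ A₀, ContDiffPointwiseHolderAt (k + 1) 1 φ w) ∧
      φ '' A₀ ∈ 𝓝[A] x := by
  obtain ⟨hg0, hPH⟩ := hg.self_of_nhdsWithin hx
  set D := fderiv ℝ g x with hD
  let K : Submodule ℝ F := LinearMap.ker (D : F →ₗ[ℝ] ℝ)
  obtain ⟨π₀, hπ₀⟩ := K.subtype.exists_leftInverse_of_injective (by simp)
  let π : F →L[ℝ] K := LinearMap.toContinuousLinearMap π₀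
  have hπ : ∀ w : K, π w = w := fun w => LinearMap.congr_fun hπ₀ w
  have hrank : finrank ℝ K + 1 = finrank ℝ F := by
    have h1 := LinearMap.finrank_range_add_finrank_ker (D : F →ₗ[ℝ] ℝ)
    have h2 : LinearMap.range (D : F →ₗ[ℝ] ℝ) = ⊤ :=
      LinearMap.range_eq_top.2 (LinearMap.surjective (fun h => hd (by ext v; exact LinearMap.congr_fun h v)))
    rw [h2, finrank_top, finrank_self] at h1
    rw [← h1, add_comm]
  have hinj : Function.Injective (D.prod π) := by
    rw [injective_iff_map_eq_zero]
    intro v hv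
    have hv1 : D v = 0 := congrArg Prod.fst hv
    have hv2 : π v = 0 := congrArg Prod.snd hv
    have := hπ ⟨v, hv1⟩
    rw [hv2] at this
    simpa using congrArg Subtype.val this.symm
  let e : F ≃L[ℝ] ℝ × K := (LinearEquiv.ofInjectiveOfFinrankEq (D.prod π : F →ₗ[ℝ] ℝ × K) hinj
    (by rw [finrank_prod, finrank_self]; omega)).toContinuousLinearEquiv
  have he : (e : F →L[ℝ] ℝ × K) = D.prod π := by ext v <;> rfl
  -- Ψ straightens {g = 0} into {0} × K; the parametrization is w ↦ Ψ⁻¹(0, w).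
  let Ψ : F → ℝ × K := fun z => (g z, π z)
  have hΨPH : ∀ z, ContDiffPointwiseHolderAt (k + 1) 1 g z →
      ContDiffPointwiseHolderAt (k + 1) 1 Ψ z := fun z hz =>
    hz.prodMk π.contDiffPointwiseHolderAt
  have hΨd : ∀ z, DifferentiableAt ℝ g z → HasFDerivAt Ψ ((fderiv ℝ g z).prod π) z :=
    fun z hz => hz.hasFDerivAt.prodMk π.hasFDerivAt
  have hΨx : HasFDerivAt Ψ (e : F →L[ℝ] ℝ × K) x := by
    rw [he]; exact hΨd x (hPH.differentiableAt (by simp))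
  have hΨc := (hΨPH x hPH).contDiffAt
  let Φ := hΨc.toOpenPartialHomeomorph Ψ hΨx (by simp)
  have hΦ : ∀ z, Φ z = Ψ z := fun z => rfl
  have hxs : x ∈ Φ.source := hΨc.mem_toOpenPartialHomeomorph_source hΨx (by simp)
  -- Pointwise Hölder regularity of the inverse is required at every point of the piece, so the
  -- differential must be invertible at all points of A near x, not only at x.
  have hequiv : ∀ᶠ z in 𝓝 x, (fderiv ℝ g z).prod π ∈
      range ((↑) : (F ≃L[ℝ] ℝ × K) → F →L[ℝ] ℝ × K) := by
    have hc : ContinuousAt (fun z => (fderiv ℝ g z).prod π) x :=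
      (ContinuousLinearMap.prodₗᵢ (E := F) (F := ℝ) (G := K) (𝕜 := ℝ) ℝ).continuous.continuousAt.comp
        (f := fun z => (fderiv ℝ g z, π)) ((hPH.fderiv (Nat.lt_succ_self k)).continuousAt.prodMk continuousAt_const)
    exact hc.eventually_mem (by rw [← hD, ← he]; exact ContinuousLinearEquiv.nhds e)
  have hN : ∀ᶠ z in 𝓝[A] x, z ∈ Φ.source ∧ g z = 0 ∧
      ContDiffPointwiseHolderAt (k + 1) 1 g z ∧ (fderiv ℝ g z).prod π ∈
      range ((↑) : (F ≃L[ℝ] ℝ × K) → F →L[ℝ] ℝ × K) := by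
    filter_upwards [hg, hequiv.filter_mono nhdsWithin_le_nhds,
      mem_nhdsWithin_of_mem_nhds (Φ.open_source.mem_nhds hxs)]
      with z h1 h2 h3 using ⟨h3, h1.1, h1.2, h2⟩
  set N := {z | z ∈ Φ.source ∧ g z = 0 ∧ ContDiffPointwiseHolderAt (k + 1) 1 g z ∧
    (fderiv ℝ g z).prod π ∈ range ((↑) : (F ≃L[ℝ] ℝ × K) → F →L[ℝ] ℝ × K)} with hNdef
  have hφπ : ∀ z ∈ N, Φ.symm (0, π z) = z := fun z hz => by
    have : ((0 : ℝ), π z) = Φ z := by rw [hΦ]; simp [Ψ, hz.2.1]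
    rw [this, Φ.left_inv hz.1]
  refine ⟨K, fun w => Φ.symm (0, w), π '' (A ∩ N), by omega, ?_, ?_, ?_⟩
  · rintro _ ⟨z, ⟨hzA, hzN⟩, rfl⟩
    simpa only [hφπ z hzN] using hzA
  · rintro _ ⟨z, ⟨hzA, hzN⟩, rfl⟩
    obtain ⟨hzs, hz0, hzP, e', he'⟩ := id hzN
    have hmem : ((0 : ℝ), π z) ∈ Φ.target := by
      have : ((0 : ℝ), π z) = Φ z := by rw [hΦ]; simp [Ψ, hz0]
      rw [this]; exact Φ.map_source hzs
    have hsymm : ContDiffPointwiseHolderAt (k + 1) 1 Φ.symm ((0 : ℝ), π z) := by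
      refine Φ.contDiffPointwiseHolderAt_symm hmem (Φ' := e') ?_ ?_
      · rw [hφπ z hzN, he']
        exact hΨd z (hzP.differentiableAt (by simp))
      · rw [hφπ z hzN]
        exact hΨPH z hzP
    refine ContDiffPointwiseHolderAt.comp (g := Φ.symm) (f := fun w : K => ((0 : ℝ), w)) (π z)
      hsymm ?_ (by simp)
    exact (ContinuousLinearMap.inr ℝ ℝ K).contDiffPointwiseHolderAt
  · filter_upwards [hN, self_mem_nhdsWithin] with z hzN hzA
    exact ⟨π z, ⟨z, ⟨hzA, hzN⟩, rfl⟩, hφπ z hzN⟩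

/-- Every set `A` is covered by countably many flat pieces (a form of the generalized Morse
lemma). -/
theorem hasFlatCover [FiniteDimensional ℝ P] (k : ℕ) :
    ∀ (n : ℕ) (F : Type) [NormedAddCommGroup F] [NormedSpace ℝ F] [FiniteDimensional ℝ F],
      finrank ℝ F = n → n ≤ finrank ℝ P → ∀ A : Set F, HasFlatCover P k A A := by
  -- The outer induction on the order ranges over all dimensions and all sets; the inner one is on
  -- the dimension of F.
  induction k with
  | zero =>
    rintro n F _ _ _ rfl hn A
    exact hasFlatCover_zero hn A
  | succ k ihk =>
    intro n
    induction n using Nat.strong_induction_on with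
    | _ n ihn =>
      rintro F _ _ _ rfl hn A
      have : ProperSpace F := FiniteDimensional.proper ℝ F
      -- Near a point of S the set A lies in a hypersurface, so the dimension drops; on A \ S all
      -- differentials vanish, so the order drops.
      let S := {x ∈ A | ∃ g : F → ℝ, VanishesNear (k + 1) A g x ∧ fderiv ℝ g x ≠ 0}
      have hS : HasFlatCover P (k + 1) A S := by
        refine HasFlatCover.of_forall_nhdsWithin ?_
        rintro x ⟨hxA, g, hg, hd⟩
        obtain ⟨K, φ, A₀, hK, hφA, hφ, hmem⟩ := exists_parametrization hxA hg hd
        exact ⟨φ '' A₀, nhdsWithin_mono x (sep_subset _ _) hmem,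
          (ihn _ hK K rfl (hK.le.trans hn) A₀).image hφA hφ⟩
      have hT : HasFlatCover P (k + 1) A (A \ S) := by
        -- The cover of lower order is taken relative to A \ S, not A: the differentials are known
        -- to vanish only there.
        refine HasFlatCover.succ_of_critical sdiff_subset ?_ (ihk _ F rfl hn _)
        intro g x hx hg
        by_contra hne
        exact hx.2 ⟨hx.1, g, hg, hne⟩
      exact (hS.union hT).mono fun x hx => by
        by_cases h : x ∈ S
        · exact .inl h
        · exact .inr ⟨hx, h⟩

end Sard

/-! ### Null images from density points; the Morse–Sard theorem -/

section Null

open Set Filter Topology Asymptotics MeasureTheory Module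
open scoped NNReal ENNReal

theorem exists_measurable_partition_dist_lt {X : Type*} [PseudoMetricSpace X] [Nonempty X]
    [TopologicalSpace.SeparableSpace X] [MeasurableSpace X] [OpensMeasurableSpace X]
    {δ : ℝ} (hδ : 0 < δ) :
    ∃ Q : ℕ → Set X, (∀ n, MeasurableSet (Q n)) ∧ Pairwise (Function.onFun Disjoint Q) ∧
      ⋃ n, Q n = univ ∧ ∀ n, ∀ x ∈ Q n, ∀ y ∈ Q n, dist x y < δ := by
  let b : ℕ → Set X := fun n => Metric.ball (TopologicalSpace.denseSeq X n) (δ / 2)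
  refine ⟨disjointed b, fun n => MeasurableSet.disjointed (fun n => measurableSet_ball) n,
    disjoint_disjointed b, ?_, fun n x hx y hy => ?_⟩
  · rw [iUnion_disjointed, eq_univ_iff_forall]
    intro x
    obtain ⟨n, hn⟩ := (TopologicalSpace.denseRange_denseSeq X).exists_dist_lt x (half_pos hδ)
    exact mem_iUnion.2 ⟨n, hn⟩
  · have hx' := disjointed_subset b n hx
    have hy' := disjointed_subset b n hy
    have := dist_triangle_right x y (TopologicalSpace.denseSeq X n)
    simp only [b, Metric.mem_ball] at hx' hy'
    linarith

/-- A function that is Hölder of exponent `m` at small scales on `S ⊆ ℝ^m` maps `S` to a set of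
controlled measure. -/
theorem volume_image_le_of_dist_le {m : ℕ} (hm : 0 < m) {h : (Fin m → ℝ) → ℝ}
    {S : Set (Fin m → ℝ)} {ε : ℝ≥0} {δ : ℝ} (hδ : 0 < δ)
    (H : ∀ x ∈ S, ∀ y ∈ S, dist x y < δ → dist (h x) (h y) ≤ ε * dist x y ^ m) :
    volume (h '' S) ≤ ε * volume S := by
  obtain ⟨Q, hQm, hQd, hQu, hQ⟩ := exists_measurable_partition_dist_lt (X := Fin m → ℝ) hδ
  have hpiece : ∀ n, volume (h '' (S ∩ Q n)) ≤ ε * volume (S ∩ Q n) := fun n => by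
    have hH : HolderOnWith ε (m : ℝ≥0) h (S ∩ Q n) := fun x hx y hy => by
      have h1 := H x hx.1 y hy.1 (hQ n x hx.2 y hy.2)
      rw [NNReal.coe_natCast, ENNReal.rpow_natCast, edist_dist, edist_dist,
        ← ENNReal.ofReal_pow dist_nonneg, ← ENNReal.ofReal_coe_nnreal,
        ← ENNReal.ofReal_mul ε.coe_nonneg]
      exact ENNReal.ofReal_le_ofReal h1
    have h2 := hH.hausdorffMeasure_image_le (by exact_mod_cast hm) zero_le_one
    -- For the sup norm of `Fin m → ℝ`, m-dimensional Hausdorff measure is exactly Lebesgue measure,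
    -- so no constant is lost.
    have h3 : (μH[((m : ℝ≥0) : ℝ) * 1] : Measure (Fin m → ℝ)) = volume := by
      rw [mul_one, NNReal.coe_natCast]
      simpa using hausdorffMeasure_pi_real (ι := Fin m)
    rwa [h3, hausdorffMeasure_real, ENNReal.rpow_one] at h2
  calc volume (h '' S) = volume (⋃ n, h '' (S ∩ Q n)) := by
        rw [← image_iUnion, ← inter_iUnion, hQu, inter_univ]
    _ ≤ ∑' n, volume (h '' (S ∩ Q n)) := measure_iUnion_le _
    _ ≤ ∑' n, ε * volume (S ∩ Q n) := ENNReal.tsum_le_tsum hpiece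
    _ = ε * ∑' n, volume.restrict S (Q n) := by
        rw [ENNReal.tsum_mul_left]
        simp only [Measure.restrict_apply (hQm _), inter_comm]
    _ = ε * volume S := by
        rw [← measure_iUnion hQd hQm, hQu, Measure.restrict_apply_univ]

/-- At a density point of `B`, the points of `B` are dense at small scales. -/
theorem eventually_exists_mem_dist_lt {m : ℕ} {B : Set (Fin m → ℝ)} {y : Fin m → ℝ}
    (hy : Tendsto (fun r => volume (B ∩ Metric.closedBall y r) / volume (Metric.closedBall y r))
      (𝓝[>] 0) (𝓝 1)) {η : ℝ} (hη : 0 < η) (hη1 : η ≤ 1) :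
    ∀ᶠ r in 𝓝[>] (0 : ℝ), ∀ z ∈ Metric.closedBall y r, ∃ b ∈ B, dist b z < η * r := by
  -- (η/2)^m is the volume ratio of a ball of radius η r to one of radius 2r. The doubled radius
  -- keeps the ball about z inside the ball about y.
  have hc0 : (0 : ℝ) < (η / 2) ^ m := by positivity
  have hlt : 1 - ENNReal.ofReal ((η / 2) ^ m) < 1 :=
    ENNReal.sub_lt_self (by simp) (by simp) (by simpa using hc0)
  have htwo : Tendsto (fun r : ℝ => 2 * r) (𝓝[>] 0) (𝓝[>] 0) := by
    refine tendsto_nhdsWithin_iff.2 ⟨?_, ?_⟩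
    · have : Tendsto (fun r : ℝ => 2 * r) (𝓝 0) (𝓝 (2 * 0)) := (continuous_const_mul 2).tendsto 0
      rw [mul_zero] at this
      exact this.mono_left nhdsWithin_le_nhds
    · filter_upwards [self_mem_nhdsWithin] with r hr
      exact mul_pos two_pos (mem_Ioi.1 hr)
  filter_upwards [htwo.eventually (hy.eventually (lt_mem_nhds hlt)), self_mem_nhdsWithin]
    with r hr hr0 z hz
  have hr0 : 0 < r := hr0
  by_contra! hcon
  set V := volume (Metric.closedBall y (2 * r)) with hV
  have hVval : V = ENNReal.ofReal ((4 * r) ^ m) := by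
    rw [hV, Real.volume_pi_closedBall y (by positivity), Fintype.card_fin]; ring_nf
  have hV0 : V ≠ 0 := by rw [hVval]; simp only [ne_eq, ENNReal.ofReal_eq_zero, not_le]; positivity
  have hVt : V ≠ ∞ := by rw [hVval]; exact ENNReal.ofReal_ne_top
  have hball : volume (Metric.ball z (η * r)) = ENNReal.ofReal ((η / 2) ^ m) * V := by
    rw [hVval, Real.volume_pi_ball z (by positivity), Fintype.card_fin,
      ← ENNReal.ofReal_mul (by positivity), ← mul_pow]
    ring_nf
  have hsub : Metric.ball z (η * r) ⊆ Metric.closedBall y (2 * r) := by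
    refine Metric.ball_subset_closedBall.trans (Metric.closedBall_subset_closedBall' ?_)
    have := Metric.mem_closedBall.1 hz
    nlinarith
  have hBsub : B ∩ Metric.closedBall y (2 * r) ⊆
      Metric.closedBall y (2 * r) \ Metric.ball z (η * r) := fun b hb =>
    ⟨hb.2, fun hbz => absurd (Metric.mem_ball.1 hbz) (not_lt.2 (hcon b hb.1))⟩
  have hle : volume (B ∩ Metric.closedBall y (2 * r)) ≤ V - ENNReal.ofReal ((η / 2) ^ m) * V := by
    refine (measure_mono hBsub).trans ?_
    rw [measure_sdiff hsub measurableSet_ball.nullMeasurableSet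
      (ne_top_of_le_ne_top hVt (measure_mono hsub)), hball]
  have : volume (B ∩ Metric.closedBall y (2 * r)) / V ≤ 1 - ENNReal.ofReal ((η / 2) ^ m) := by
    rw [ENNReal.div_le_iff hV0 hVt, ENNReal.sub_mul (fun _ _ => hVt), one_mul]
    exact hle
  exact absurd hr (not_lt.2 this)

/-- At density points of `B`, an estimate `O(dist x y ^ m)` on `B`, `m ≥ 2`, improves itself to
`o(dist x y ^ m)`. -/
theorem exists_forall_dist_le_of_density {m : ℕ} (hm : 2 ≤ m) {h : (Fin m → ℝ) → ℝ}
    {B : Set (Fin m → ℝ)} {C : ℝ≥0} {δ : ℝ} (hδ : 0 < δ)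
    (H : ∀ x ∈ B, ∀ y ∈ B, dist x y < δ → dist (h x) (h y) ≤ C * dist x y ^ m)
    {y : Fin m → ℝ} (hyB : y ∈ B)
    (hy : Tendsto (fun r => volume (B ∩ Metric.closedBall y r) / volume (Metric.closedBall y r))
      (𝓝[>] 0) (𝓝 1)) {ε : ℝ} (hε : 0 < ε) :
    ∃ δ' > 0, ∀ x ∈ B, dist x y < δ' → dist (h x) (h y) ≤ ε * dist x y ^ m := by
  -- L ≥ 3 keeps each step, of length at most 3r/L, below δ; the other bound makes the total cost at
  -- most ε r^m.
  obtain ⟨L, hL⟩ := exists_nat_ge (max 3 (C * 3 ^ m / ε))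
  have hL3 : (3 : ℝ) ≤ L := (le_max_left _ _).trans hL
  have hL0 : (0 : ℝ) < L := by linarith
  have hLC : C * 3 ^ m ≤ ε * L := by
    have := (div_le_iff₀ hε).1 ((le_max_right _ _).trans hL)
    linarith
  have hev := eventually_exists_mem_dist_lt hy (η := 1 / L) (by positivity)
    ((div_le_one hL0).2 (by linarith))
  obtain ⟨δ₁, hδ₁, hδ₁'⟩ := mem_nhdsGT_iff_exists_Ioo_subset.1 hev
  have hδ₁ : 0 < δ₁ := hδ₁
  refine ⟨min δ δ₁, lt_min hδ hδ₁, fun x hxB hxy => ?_⟩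
  rcases eq_or_ne x y with rfl | hne
  · simp only [dist_self]; positivity
  set r := dist x y with hr
  have hr0 : 0 < r := dist_pos.2 hne
  have hdense := hδ₁' ⟨hr0, hxy.trans_le (min_le_right _ _)⟩
  simp only [mem_ofPred_eq] at hdense
  let z : ℕ → Fin m → ℝ := fun i => y + ((i : ℝ) / L) • (x - y)
  have hz : ∀ i j : ℕ, dist (z i) (z j) = |(i : ℝ) - j| / L * r := fun i j => by
    rw [dist_eq_norm, hr, dist_eq_norm, show z i - z j = (((i : ℝ) - j) / L) • (x - y) by
      simp only [z]; rw [add_sub_add_left_eq_sub, ← sub_smul, sub_div], norm_smul, Real.norm_eq_abs,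
      abs_div, abs_of_pos hL0]
  have hz0 : z 0 = y := by simp [z]
  have hzL : z L = x := by simp [z, div_self hL0.ne']
  -- Points of B within r/L of the subdivision points of the segment from y to x, with both
  -- endpoints kept exactly.
  have hw : ∀ i : ℕ, ∃ b, i ≤ L → b ∈ B ∧ dist b (z i) < r / L ∧ (i = 0 → b = y) ∧
      (i = L → b = x) := fun i => by
    by_cases h0 : i = 0
    · refine ⟨y, fun _ => ⟨hyB, ?_, fun _ => rfl, fun h => ?_⟩⟩
      · rw [h0, hz0, dist_self]; positivity
      · rw [← h, h0] at hL0; simp at hL0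
    by_cases hiL : i = L
    · refine ⟨x, fun _ => ⟨hxB, ?_, fun h => absurd h h0, fun _ => rfl⟩⟩
      rw [hiL, hzL, dist_self]; positivity
    by_cases hi : i ≤ L
    · obtain ⟨b, hb, hbz⟩ := hdense (z i) (by
        rw [Metric.mem_closedBall]
        conv_lhs => rw [← hz0]
        rw [hz, Nat.cast_zero, sub_zero, abs_of_nonneg (by positivity)]
        have : (i : ℝ) / L ≤ 1 := (div_le_one hL0).2 (by exact_mod_cast hi)
        nlinarith)
      exact ⟨b, fun _ => ⟨hb, by rwa [one_div_mul_eq_div] at hbz, fun h => absurd h h0,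
        fun h => absurd h hiL⟩⟩
    · exact ⟨y, fun h => absurd h hi⟩
  choose w hw using hw
  have hstep : ∀ i < L, dist (h (w i)) (h (w (i + 1))) ≤ C * (3 * r / L) ^ m := fun i hi => by
    obtain ⟨hb1, hd1, -⟩ := hw i hi.le
    obtain ⟨hb2, hd2, -⟩ := hw (i + 1) hi
    have hzz : dist (z i) (z (i + 1)) = r / L := by
      rw [hz]; push_cast; rw [show (i : ℝ) - (i + 1) = -1 by ring, abs_neg, abs_one]; ring
    have hd : dist (w i) (w (i + 1)) ≤ 3 * r / L := by
      have := dist_triangle4 (w i) (z i) (z (i + 1)) (w (i + 1))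
      rw [dist_comm (z (i + 1))] at this
      have h3 : 3 * r / L = r / L + r / L + r / L := by ring
      linarith
    have hdδ : dist (w i) (w (i + 1)) < δ := by
      refine hd.trans_lt (lt_of_le_of_lt ?_ (hxy.trans_le (min_le_left _ _)))
      rw [div_le_iff₀ hL0]; nlinarith
    exact (H _ hb1 _ hb2 hdδ).trans (by gcongr)
  have hsum : dist (h (w 0)) (h (w L)) ≤ ∑ i ∈ Finset.range L, C * (3 * r / L) ^ m :=
    dist_le_range_sum_of_dist_le (f := fun i => h (w i)) L fun {i} hi => hstep i hi
  rw [(hw 0 (Nat.zero_le _)).2.2.1 rfl, (hw L le_rfl).2.2.2 rfl, Finset.sum_const,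
    Finset.card_range, nsmul_eq_mul, dist_comm] at hsum
  refine hsum.trans ?_
  -- The total is C 3^m r^m / L^(m-1), and m ≥ 2 gives L^(m-1) ≥ L.
  obtain ⟨j, rfl⟩ : ∃ j, m = j + 2 := ⟨m - 2, by omega⟩
  have hLj : (1 : ℝ) ≤ (L : ℝ) ^ j := one_le_pow₀ (by linarith)
  have e : (L : ℝ) * (C * (3 * r / L) ^ (j + 2)) =
      (C * 3 ^ (j + 2)) / (L ^ j * L) * r ^ (j + 2) := by
    rw [div_pow, mul_pow]; field_simp; ring
  rw [e]
  gcongr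
  rw [div_le_iff₀ (by positivity)]
  nlinarith [mul_nonneg (mul_nonneg hε.le hL0.le) (sub_nonneg.2 hLj)]

/-- The points of B that are not density points form a null set, whose image is null by the Hölder
bound. The density points are an increasing union of sets on which the improved estimate with
constant ε holds at a fixed scale, so their image has measure at most ε · vol(B) for every ε.
Measurability of B plays no role. -/
theorem volume_image_eq_zero_of_uniform {m : ℕ} (hm : 2 ≤ m) {h : (Fin m → ℝ) → ℝ}
    {B : Set (Fin m → ℝ)} (hB : volume B ≠ ∞) {C : ℝ≥0} {δ : ℝ} (hδ : 0 < δ)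
    (H : ∀ x ∈ B, ∀ y ∈ B, dist x y < δ → dist (h x) (h y) ≤ C * dist x y ^ m) :
    volume (h '' B) = 0 := by
  let D := {y ∈ B | Tendsto (fun r => volume (B ∩ Metric.closedBall y r) /
    volume (Metric.closedBall y r)) (𝓝[>] 0) (𝓝 1)}
  have hnull : volume (B \ D) = 0 := by
    have h1 := Besicovitch.ae_tendsto_measure_inter_div (volume : Measure (Fin m → ℝ)) B
    have h2 := ae_imp_of_ae_restrict h1
    refine measure_mono_null (fun y hy => ?_) (ae_iff.1 h2)
    simp only [mem_ofPred_eq, Classical.not_imp]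
    exact ⟨hy.1, fun ht => hy.2 ⟨hy.1, ht⟩⟩
  have hbad : volume (h '' (B \ D)) = 0 := by
    have := volume_image_le_of_dist_le (by omega) hδ
      (fun x (hx : x ∈ B \ D) y (hy : y ∈ B \ D) => H x hx.1 y hy.1)
    rwa [hnull, mul_zero, nonpos_iff_eq_zero] at this
  have hgood : ∀ ε : ℝ≥0, 0 < ε → volume (h '' D) ≤ ε * volume B := fun ε hε => by
    let S : ℕ → Set (Fin m → ℝ) := fun N =>
      {y ∈ D | ∀ x ∈ B, dist x y < 1 / (N + 1 : ℝ) → dist (h x) (h y) ≤ ε * dist x y ^ m}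
    have hS : D = ⋃ N, S N := by
      refine subset_antisymm (fun y hy => ?_) (iUnion_subset fun N => sep_subset _ _)
      obtain ⟨δ', hδ', hx⟩ := exists_forall_dist_le_of_density hm hδ H hy.1 hy.2
        (ε := ε) (by exact_mod_cast hε)
      obtain ⟨N, hN⟩ := exists_nat_one_div_lt hδ'
      exact mem_iUnion.2 ⟨N, hy, fun x hxB hxy => hx x hxB (hxy.trans hN)⟩
    have hmono : Monotone S := fun N N' hN y hy => ⟨hy.1, fun x hxB hxy => hy.2 x hxB
      (hxy.trans_le (one_div_le_one_div_of_le (by positivity) (by gcongr)))⟩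
    rw [hS, image_iUnion, Monotone.measure_iUnion fun N N' hN => image_mono (hmono hN)]
    refine iSup_le fun N => ?_
    refine (volume_image_le_of_dist_le (S := S N) (ε := ε) (by omega)
      (by positivity : (0 : ℝ) < 1 / (N + 1)) fun x hx y hy => hy.2 x hx.1.1).trans ?_
    gcongr
    exact fun y hy => hy.1.1
  have hgood0 : volume (h '' D) = 0 := by
    refine le_antisymm (ENNReal.le_of_forall_pos_le_add fun ε hε _ => ?_) zero_le
    rw [zero_add]
    have hB' : (volume B).toNNReal + 1 ≠ 0 := by positivity
    refine (hgood (ε / ((volume B).toNNReal + 1)) (by positivity)).trans ?_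
    rw [← ENNReal.coe_toNNReal hB]
    norm_cast
    rw [div_mul_eq_mul_div]
    exact div_le_of_le_mul₀ (by positivity) (by positivity) (by gcongr; simp)
  have : h '' B ⊆ h '' D ∪ h '' (B \ D) := by
    rw [← image_union]
    exact image_mono fun y hy => by
      by_cases hD : y ∈ D
      · exact .inl hD
      · exact .inr ⟨hy, hD⟩
  exact measure_mono_null this (measure_union_null hgood0 hbad)

/-- If `h x - h y = O(‖x - y‖ ^ m)` at every point `y` of `B ⊆ ℝ^m`, `m ≥ 2`, then `h '' B` is a
null set. -/
theorem volume_image_eq_zero_of_isBigO {m : ℕ} (hm : 2 ≤ m) {h : (Fin m → ℝ) → ℝ}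
    {B : Set (Fin m → ℝ)}
    (H : ∀ y ∈ B, (fun x => h x - h y) =O[𝓝 y] fun x => ‖x - y‖ ^ m) :
    volume (h '' B) = 0 := by
  -- Countably many bounded pieces, on each of which the constant and the scale of the O-estimate
  -- are uniform.
  let S : ℕ → Set (Fin m → ℝ) := fun N => {y ∈ B ∩ Metric.ball 0 N |
    ∀ x, dist x y < 1 / (N + 1 : ℝ) → dist (h x) (h y) ≤ (N : ℝ≥0) * dist x y ^ m}
  have hS : B ⊆ ⋃ N, S N := fun y hy => by
    obtain ⟨c, hc⟩ := (H y hy).bound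
    obtain ⟨ε, hε, hball⟩ := Metric.eventually_nhds_iff.1 hc
    obtain ⟨N₁, hN₁⟩ := exists_nat_one_div_lt hε
    obtain ⟨N₂, hN₂⟩ := exists_nat_gt (max c ‖y‖)
    have h1 : (N₁ : ℝ) ≤ max (N₁ : ℝ) N₂ := le_max_left _ _
    have h2 : (N₂ : ℝ) ≤ max (N₁ : ℝ) N₂ := le_max_right _ _
    refine mem_iUnion.2 ⟨max N₁ N₂, ⟨hy, ?_⟩, fun x hx => ?_⟩
    · rw [mem_ball_zero_iff]
      push_cast
      exact ((le_max_right _ _).trans_lt hN₂).trans_le h2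
    · push_cast at hx ⊢
      have hx' : dist x y < ε := (hx.trans_le (one_div_le_one_div_of_le (by positivity)
        (by gcongr))).trans hN₁
      have := hball hx'
      rw [norm_pow, norm_norm, ← dist_eq_norm, ← dist_eq_norm] at this
      refine this.trans ?_
      gcongr
      exact ((le_max_left _ _).trans_lt hN₂).le.trans h2
  refine measure_mono_null (image_mono hS) ?_
  rw [image_iUnion]
  refine measure_iUnion_null fun N => ?_
  refine volume_image_eq_zero_of_uniform hm ?_ (by positivity : (0 : ℝ) < 1 / (N + 1))
    fun x hx y hy => hy.2 x
  exact ne_top_of_le_ne_top measure_ball_lt_top.ne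
    (measure_mono (show S N ⊆ Metric.ball 0 N from fun y hy => hy.1.2))

/-- **Morse–Sard theorem** for functions of class `C^{k+(1)}` on a space of dimension `k + 1`. -/
theorem volume_image_critical_eq_zero {F : Type} [NormedAddCommGroup F] [NormedSpace ℝ F]
    [FiniteDimensional ℝ F] {k : ℕ} (hk : k ≠ 0) (hF : finrank ℝ F = k + 1) {f : F → ℝ} {A : Set F}
    (hf : ∀ x ∈ A, ContDiffPointwiseHolderAt k 1 f x) (hA : ∀ x ∈ A, fderiv ℝ f x = 0) :
    volume (f '' A) = 0 := by
  obtain ⟨j, rfl⟩ := Nat.exists_eq_succ_of_ne_zero hk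
  obtain ⟨𝒞, h1, h2, h3⟩ := hasFlatCover (P := Fin (j + 2) → ℝ) j _ F rfl (by simp [hF]) A
  refine measure_mono_null (image_mono h3) ?_
  rw [image_iUnion₂]
  refine (measure_biUnion_null_iff h1).2 fun p hp => ?_
  rw [← image_comp]
  refine volume_image_eq_zero_of_isBigO (by omega) fun y hy => ?_
  have hp' := h2 p hp
  -- With k = j + 1, Df is C^{j+(1)} and vanishes on A, so it is O(‖x - y‖^(j+1)) along the piece;
  -- integration yields the exponent j + 2, which is the dimension.
  refine isBigO_comp_sub_pow_succ (j := j + 1) (g := f) (ψ := p.1)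
    ((hf _ (hp'.mapsTo hy)).contDiffAt.of_le (by norm_cast; omega)) (hp'.contDiffAt y hy)
    (hp'.isBigO _ (fderiv ℝ f) y hy ?_)
  filter_upwards [self_mem_nhdsWithin] with z hz
  exact ⟨hA z hz, (hf z hz).fderiv (Nat.lt_succ_self j)⟩

end Null

/-! ### Regular values of the argument and the continuous root -/

section Radical

open Set Filter Topology Asymptotics MeasureTheory Module
open scoped ComplexOrder

variable {m : ℕ} {Ω : Set (EuclideanSpace ℝ (Fin m))} {f : EuclideanSpace ℝ (Fin m) → ℂ}

theorem IsCkLip.contDiffPointwiseHolderAt {k : ℕ} (hf : IsCkLip k f Ω) (hΩ : IsOpen Ω)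
    {x : EuclideanSpace ℝ (Fin m)} (hx : x ∈ Ω) : ContDiffPointwiseHolderAt k 1 f x where
  contDiffAt := hf.1.contDiffAt (hΩ.mem_nhds hx)
  isBigO := by
    obtain ⟨K, t, ht, hK⟩ := hf.2 hx
    rw [hΩ.nhdsWithin_eq hx] at ht
    refine .of_bound K ?_
    filter_upwards [ht] with y hy
    have := hK.dist_le_mul y hy x (mem_of_mem_nhds ht)
    simpa [dist_eq_norm] using this

theorem contDiffAt_arg {n : WithTop ℕ∞} {z : ℂ} (hz : z ∈ Complex.slitPlane) :
    ContDiffAt ℝ n Complex.arg z := by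
  have h : ContDiffAt ℝ n Complex.log z := (Complex.contDiffAt_log hz).restrict_scalars ℝ
  have := Complex.imCLM.contDiff.contDiffAt.comp z h
  simpa [Function.comp_def, Complex.log_im] using this

theorem sgnFun_eq_exp_arg {x : EuclideanSpace ℝ (Fin m)} (hx : f x ≠ 0) :
    sgnFun f x = Complex.exp ((f x).arg * Complex.I) := by
  have : (‖f x‖ : ℂ) ≠ 0 := by simpa using hx
  rw [sgnFun, div_eq_iff this, mul_comm, Complex.norm_mul_exp_arg_mul_I]

theorem sgnFun_eq_iff {x : EuclideanSpace ℝ (Fin m)} (hx : f x ≠ 0) {t : ℝ}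
    (ht : t ∈ Ioc (-Real.pi) Real.pi) :
    sgnFun f x = Complex.exp (t * Complex.I) ↔ (f x).arg = t := by
  rw [sgnFun_eq_exp_arg hx]
  refine ⟨fun h => ?_, fun h => by rw [h]⟩
  have := congrArg Complex.arg h
  have hper : -Real.pi + 2 * Real.pi = Real.pi := by ring
  rwa [Complex.arg_exp_mul_I, Complex.arg_exp_mul_I,
    (toIocMod_eq_self _).2 (by rw [hper]; exact Complex.arg_mem_Ioc (f x)),
    (toIocMod_eq_self _).2 (by rw [hper]; exact ht)] at this

theorem mem_slitPlane_of_arg_mem_Ioo {z : ℂ} (hz : z ≠ 0)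
    (h : z.arg ∈ Ioo (-Real.pi) Real.pi) : z ∈ Complex.slitPlane :=
  Complex.mem_slitPlane_iff_arg.2 ⟨h.2.ne, hz⟩

/-- Almost every angle is a regular value of the argument of a `C^{m-1,1}` function on `ℝ^m`. -/
theorem IsCkLip.exists_regular_arg (hm : 2 ≤ m) {k : ℕ} (hk : m - 1 ≤ k) (hΩ : IsOpen Ω)
    (hf : IsCkLip k f Ω) :
    ∃ t ∈ Ioo (-Real.pi) Real.pi, ∀ x ∈ Ω, f x ∈ Complex.slitPlane → (f x).arg = t →
      fderiv ℝ (fun y => (f y).arg) x ≠ 0 := by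
  let A := {x ∈ Ω | f x ∈ Complex.slitPlane ∧ fderiv ℝ (fun y => (f y).arg) x = 0}
  have hnull : volume ((fun y => (f y).arg) '' A) = 0 := by
    -- On the slit plane arg is smooth, so arg ∘ f has order m - 1 in dimension m = (m - 1) + 1, as
    -- Morse–Sard requires.
    refine volume_image_critical_eq_zero (k := m - 1) (by omega) (by simp; omega) ?_
      fun x hx => hx.2.2
    intro x hx
    exact ((contDiffAt_arg (n := ⊤) hx.2.1).contDiffPointwiseHolderAt
      (WithTop.coe_lt_top _) _).comp (f := f) x
        ((hf.contDiffPointwiseHolderAt hΩ hx.1).of_order_le hk) (by omega)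
  have hpos : volume (Ioo (-Real.pi) Real.pi) ≠ 0 := by
    rw [Real.volume_Ioo]
    simp [Real.pi_pos]
  obtain ⟨t, ht, htA⟩ : (Ioo (-Real.pi) Real.pi \ (fun y => (f y).arg) '' A).Nonempty := by
    rw [nonempty_iff_ne_empty]
    intro h
    exact hpos (measure_mono_null (sdiff_eq_empty.1 h) hnull)
  exact ⟨t, ht, fun x hx hs hxt h0 => htA ⟨x, ⟨hx, hs, h0⟩, hxt⟩⟩

/-- Near x, sgn f = exp(i arg f), so its differential is d(arg f) times i sgn f(x), and a nonzero
real functional is onto ℝ. -/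
theorem range_fderiv_sgnFun {x : EuclideanSpace ℝ (Fin m)} (hfx : DifferentiableAt ℝ f x)
    (hs : f x ∈ Complex.slitPlane) (hd : fderiv ℝ (fun y => (f y).arg) x ≠ 0) :
    DifferentiableAt ℝ (sgnFun f) x ∧
      range (fderiv ℝ (sgnFun f) x) = {w : ℂ | ∃ t : ℝ, w = t * (Complex.I * sgnFun f x)} := by
  have hev : sgnFun f =ᶠ[𝓝 x] fun y => Complex.exp ((f y).arg * Complex.I) := by
    filter_upwards [hfx.continuousAt.eventually_ne (Complex.slitPlane_ne_zero hs)] with y hy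
      using sgnFun_eq_exp_arg hy
  have hargd : HasFDerivAt (fun y => (f y).arg) (fderiv ℝ (fun y => (f y).arg) x) x :=
    (((contDiffAt_arg (n := 1) hs).differentiableAt (by simp)).comp x hfx).hasFDerivAt
  have h1 : HasDerivAt (fun t : ℝ => Complex.exp (t * Complex.I))
      (Complex.exp ((f x).arg * Complex.I) * Complex.I) (f x).arg := by
    simpa using ((Complex.ofRealCLM.hasDerivAt (x := (f x).arg)).mul_const Complex.I).cexp
  have h2 := (h1.hasFDerivAt.comp x hargd).congr_of_eventuallyEq hev
  refine ⟨h2.differentiableAt, ?_⟩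
  rw [h2.fderiv, sgnFun_eq_exp_arg (Complex.slitPlane_ne_zero hs)]
  ext w
  have hsurj := LinearMap.surjective (f := (fderiv ℝ (fun y => (f y).arg) x).toLinearMap)
    (fun h => hd (by ext v; exact LinearMap.congr_fun h v))
  constructor
  · rintro ⟨v, rfl⟩
    exact ⟨fderiv ℝ (fun y => (f y).arg) x v, by simp [mul_comm]⟩
  · rintro ⟨t, rfl⟩
    obtain ⟨v, rfl⟩ := hsurj t
    exact ⟨v, by simp [mul_comm]⟩

/-- The local equation is arg f - t = 0. Excluding t = π keeps the fiber away from the negative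
axis, where arg jumps. -/
theorem isCkHypersurface_sgnFiber {k : ℕ} (hk : 1 ≤ k) (hΩ : IsOpen Ω)
    (hf : ContDiffOn ℝ k f Ω) {t : ℝ} (ht : t ∈ Ioo (-Real.pi) Real.pi)
    (hd : ∀ x ∈ Ω, f x ∈ Complex.slitPlane → (f x).arg = t →
      fderiv ℝ (fun y => (f y).arg) x ≠ 0) :
    IsCkHypersurface k (sgnFiber f Ω (Complex.exp (t * Complex.I))) := by
  rintro x ⟨hxΩ, hx0, hxv⟩
  have htc : t ∈ Ioc (-Real.pi) Real.pi := ⟨ht.1, ht.2.le⟩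
  have hxt : (f x).arg = t := (sgnFun_eq_iff hx0 htc).1 hxv
  have hxs : f x ∈ Complex.slitPlane := mem_slitPlane_of_arg_mem_Ioo hx0 (by rwa [hxt])
  let V := Ω ∩ f ⁻¹' Complex.slitPlane
  have hV : IsOpen V := hf.continuousOn.isOpen_inter_preimage hΩ Complex.isOpen_slitPlane
  have hg : ContDiffOn ℝ k (fun y => (f y).arg) V := fun y hy =>
    ((contDiffAt_arg hy.2).comp y (hf.contDiffAt (hΩ.mem_nhds hy.1))).contDiffWithinAt
  have hg' : ContinuousOn (fderiv ℝ fun y => (f y).arg) V :=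
    hg.continuousOn_fderiv_of_isOpen hV (by exact_mod_cast hk)
  refine ⟨V ∩ (fderiv ℝ fun y => (f y).arg) ⁻¹' {0}ᶜ, fun y => (f y).arg - t,
    hg'.isOpen_inter_preimage hV isOpen_compl_singleton, ⟨⟨hxΩ, hxs⟩, hd x hxΩ hxs hxt⟩,
    (hg.mono inter_subset_left).sub contDiffOn_const, fun y hy => ?_, ?_⟩
  · rw [fderiv_sub_const]
    exact hy.2
  · ext y
    simp only [sgnFiber, mem_inter_iff, mem_ofPred_eq, sub_eq_zero]
    constructor
    · rintro ⟨⟨-, hy0, hyv⟩, hyU⟩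
      exact ⟨hyU, (sgnFun_eq_iff hy0 htc).1 hyv⟩
    · rintro ⟨hyU, hyt⟩
      have hy0 := Complex.slitPlane_ne_zero hyU.1.2
      exact ⟨⟨hyU.1.1, hy0, (sgnFun_eq_iff hy0 htc).2 hyt⟩, hyU⟩

/-- Off a fiber of `sgn f`, a continuous function has a continuous `r`-th root. -/
theorem exists_isRadicalOn {r : ℝ} (hr : 0 < r) (hf : ContinuousOn f Ω) {v : ℂ} (hv : ‖v‖ = 1) :
    ∃ u : EuclideanSpace ℝ (Fin m) → ℂ, ContinuousOn u (Ω \ sgnFiber f Ω v) ∧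
      IsRadicalOn r f u (Ω \ sgnFiber f Ω v) := by
  have hv0 : v ≠ 0 := fun h => by simp [h] at hv
  -- The principal logarithm is rotated so that its cut falls on f/v ≥ 0, that is, on the fiber of v
  -- and the zeros of f; adding log(-v) restores exp L = f.
  let L : EuclideanSpace ℝ (Fin m) → ℂ := fun x => Complex.log (-(f x / v)) + Complex.log (-v)
  have hL : ∀ x, f x ≠ 0 → Complex.exp (L x) = f x := fun x hx => by
    rw [Complex.exp_add, Complex.exp_log (neg_ne_zero.2 (div_ne_zero hx hv0)),
      Complex.exp_log (neg_ne_zero.2 hv0)]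
    field_simp
  let u : EuclideanSpace ℝ (Fin m) → ℂ :=
    fun x => if f x = 0 then 0 else Complex.exp ((r : ℂ)⁻¹ * L x)
  -- Independent of the branch, this gives continuity at the zeros of f, where L itself carries no
  -- information.
  have hnorm : ∀ x, ‖u x‖ = ‖f x‖ ^ r⁻¹ := fun x => by
    by_cases hx : f x = 0
    · simp [u, hx, Real.zero_rpow (inv_ne_zero hr.ne')]
    · simp only [u, hx, if_false]
      rw [← hL x hx, Complex.norm_exp, Complex.norm_exp, ← Real.exp_mul, ← Complex.ofReal_inv,
        Complex.re_ofReal_mul, mul_comm]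
  refine ⟨u, fun x hx => ?_, fun x _ hx => if_pos hx, L, fun x _ hx => ⟨hL x hx, if_neg hx⟩⟩
  have hfx : ContinuousWithinAt f (Ω \ sgnFiber f Ω v) x := (hf x hx.1).mono sdiff_subset
  by_cases hx0 : f x = 0
  · have hux : u x = 0 := if_pos hx0
    rw [ContinuousWithinAt, hux, tendsto_zero_iff_norm_tendsto_zero]
    simp only [hnorm]
    have := hfx.norm.rpow_const (p := r⁻¹) (.inr (inv_nonneg.2 hr.le))
    simpa [ContinuousWithinAt, hx0, Real.zero_rpow (inv_ne_zero hr.ne')] using this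
  · have hslit : -(f x / v) ∈ Complex.slitPlane := by
      rw [Complex.mem_slitPlane_iff_not_le_zero]
      intro hle
      refine hx.2 ⟨hx.1, hx0, ?_⟩
      have hnn : 0 ≤ f x / v := neg_nonpos.1 hle
      have h1 : f x / v = (‖f x / v‖ : ℂ) := (Complex.norm_of_nonneg' hnn).symm
      rw [norm_div, hv, div_one, div_eq_iff hv0] at h1
      have : (‖f x‖ : ℂ) ≠ 0 := by simpa using hx0
      rw [sgnFun, div_eq_iff this, mul_comm]
      exact h1
    have hcont : ContinuousWithinAt (fun x => Complex.exp ((r : ℂ)⁻¹ * L x))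
        (Ω \ sgnFiber f Ω v) x :=
      (continuousWithinAt_const.mul
        (((hfx.div_const v).neg.clog hslit).add continuousWithinAt_const)).cexp
    refine hcont.congr_of_eventuallyEq ?_ (if_neg hx0)
    filter_upwards [hfx.eventually_ne hx0] with y hy using if_neg hy

end Radical

theorem proposition2 (r : ℝ) (hr : 1 < r) (m : ℕ) (hm : 2 ≤ m) (k : ℕ) (hk : m - 1 ≤ k)
    (Ω : Set (EuclideanSpace ℝ (Fin m))) (hΩ : IsOpen Ω)
    (f : EuclideanSpace ℝ (Fin m) → ℂ) (hf : IsCkLip k f Ω) :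
    ∃ E : Set (EuclideanSpace ℝ (Fin m)), E ⊆ Ω ∧ IsCkHypersurface k E ∧
      (∃ v : ℂ, IsRegularValueSgn f Ω v ∧ E = sgnFiber f Ω v) ∧
      ∃ u : EuclideanSpace ℝ (Fin m) → ℂ,
        ContinuousOn u (Ω \ E) ∧ IsRadicalOn r f u (Ω \ E) := by
  obtain ⟨t, ht, hd⟩ := hf.exists_regular_arg hm hk hΩ
  have hk1 : 1 ≤ k := by omega
  have hv : ‖Complex.exp (t * Complex.I)‖ = 1 := Complex.norm_exp_ofReal_mul_I t
  refine ⟨sgnFiber f Ω (Complex.exp (t * Complex.I)), fun x hx => hx.1,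
    isCkHypersurface_sgnFiber hk1 hΩ hf.1 ht hd, ⟨_, ⟨hv, ?_⟩, rfl⟩,
    exists_isRadicalOn (by linarith) hf.1.continuousOn hv⟩
  rintro x ⟨hxΩ, hx0, hxv⟩
  have hxt : (f x).arg = t := (sgnFun_eq_iff hx0 ⟨ht.1, ht.2.le⟩).1 hxv
  have hxs : f x ∈ Complex.slitPlane := mem_slitPlane_of_arg_mem_Ioo hx0 (by rwa [hxt])
  rw [← hxv]
  exact range_fderiv_sgnFun
    ((hf.1.contDiffAt (hΩ.mem_nhds hxΩ)).differentiableAt (by norm_cast; omega)) hxs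
    (hd x hxΩ hxs hxt)
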